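/- Let $G$ be a finite connected simple graph. An edge-colouring $c:E(G)\to\mathbb N$ (not necessarily proper) is *rainbow connected* if any two vertices of $G$ are joined by a path whose edges have pairwise distinct colours, and *strongly rainbow connected* if any two vertices $u,v$ are joined by such a path of length $d_G(u,v)$. For an integer $r\ge 1$, an *$r$-edge-list assignment* of $G$ is a function $L$ assigning to each edge $e$ a set $L(e)\subseteq\mathbb N$ with at least $r$ elements, and an *$L$-edge-colouring* is a function $c:E(G)\to\mathbb N$ with $c(e)\in L(e)$ for all $e\in E(G)$. The *list rainbow connection number* $rc^\ell(G)$ (respectively, the *list strong rainbow connection number* $src^\ell(G)$) is the minimum integer $r\ge 1$ such that for every $r$-edge-list assignment $L$ of $G$ there exists an $L$-edge-colouring of $G$ that is rainbow connected (respectively, strongly rainbow connected). **Theorem.** Let $\mathsf P_{10}$ be the Petersen graph, whose vertices are the $2$-element subsets of a $5$-element set, two of them being adjacent exactly when they are disjoint. Then $$rc^\ell(\mathsf P_{10})=3\qquad\text{and}\qquad src^\ell(\mathsf P_{10})=4.$$ -/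

import Mathlib

namespace ListRainbow

variable {V : Type*} {G : SimpleGraph V}

/-- A walk is rainbow under the edge-colouring `c` if distinct edges of it have distinct colours.
It is only applied to paths, which do not repeat edges. -/
def IsRainbow (c : G.EdgeLabeling ℕ) {u v : V} (p : G.Walk u v) : Prop :=
  Set.InjOn c {e : G.edgeSet | (e : Sym2 V) ∈ p.edges}

/-- Any two vertices are connected by a rainbow path. -/
def RainbowConnected (c : G.EdgeLabeling ℕ) : Prop :=
  ∀ u v : V, ∃ p : G.Walk u v, p.IsPath ∧ IsRainbow c p

/-- Any two vertices are connected by a rainbow geodesic, that is, a rainbow path whose length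
is the distance of its end vertices. -/
def StronglyRainbowConnected (c : G.EdgeLabeling ℕ) : Prop :=
  ∀ u v : V, ∃ p : G.Walk u v, p.IsPath ∧ p.length = G.dist u v ∧ IsRainbow c p

/-- `L` is an `r`-edge-list assignment: each edge gets a list (a possibly infinite set of natural
numbers) with at least `r` elements. -/
def IsEdgeListAssignment (r : ℕ) (L : G.edgeSet → Set ℕ) : Prop :=
  ∀ e, (r : ℕ∞) ≤ (L e).encard

/-- `c` is an `L`-edge-colouring: each edge gets a colour from its own list. -/
def IsListEdgeColouring (L : G.edgeSet → Set ℕ) (c : G.EdgeLabeling ℕ) : Prop :=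
  ∀ e, c e ∈ L e

/-- The list rainbow connection number of a connected graph: the minimum positive integer `r` such
that every `r`-edge-list assignment `L` admits a rainbow connected `L`-edge-colouring. -/
noncomputable def listRainbowConnectionNumber (G : SimpleGraph V) : ℕ :=
  sInf {r : ℕ | 1 ≤ r ∧ ∀ L : G.edgeSet → Set ℕ, IsEdgeListAssignment r L →
    ∃ c : G.EdgeLabeling ℕ, IsListEdgeColouring L c ∧ RainbowConnected c}

/-- The list strong rainbow connection number of a connected graph: the minimum positive integer
`r` such that every `r`-edge-list assignment `L` admits a strongly rainbow connected
`L`-edge-colouring. -/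
noncomputable def listStrongRainbowConnectionNumber (G : SimpleGraph V) : ℕ :=
  sInf {r : ℕ | 1 ≤ r ∧ ∀ L : G.edgeSet → Set ℕ, IsEdgeListAssignment r L →
    ∃ c : G.EdgeLabeling ℕ, IsListEdgeColouring L c ∧ StronglyRainbowConnected c}

/-- The Petersen graph: the vertices are the two-element subsets of a five-element set, and two of
them are adjacent if they are disjoint. -/
def petersenGraph : SimpleGraph {s : Finset (Fin 5) // s.card = 2} where
  Adj s t := Disjoint s.1 t.1
  symm := ⟨fun _ _ h => h.symm⟩
  loopless := ⟨fun s h => by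
    have h0 : s.1 = ∅ := by simpa using h
    have h2 := s.2
    simp [h0] at h2⟩

end ListRainbow

/-!
The Petersen graph `P` has diameter two and girth five, so vertices at distance two have exactly one
common neighbour. Hence a colouring is strongly rainbow connected if and only if it is a proper
edge-colouring, and a rainbow connected colouring with only two colours is proper as well. Two
colours do not suffice because `P` has vertices of degree three, and three colours do not suffice
for strong rainbow connection because `P` is not 3-edge-colourable: in a proper 3-edge-colouring,
two of the spokes between the two pentagons of `P` would have a colour that no other spoke has, and
they would be consecutive on both pentagons.

Colours are found in the lists by the kernel method: if the conflicts can be oriented without odd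
directed cycles such that every list is larger than the out-degree, a colouring exists. For lists of
size four the line graph of `P` has such an orientation. For lists of size three, the geodesics of
six pairs of vertices are replaced by paths with three edges, each of which uses one of two disjoint
edges `f` and `g`. Then just four edges have too many out-neighbours, and these are in conflict with
both `f` and `g`. If the lists of `f` and `g` share a colour, both receive it; otherwise each of the
four edges excludes at most two of the nine ways to colour `f` and `g`, so some choice takes at most
one colour from each of them.
-/

namespace ListRainbow

section Kernels

variable {ι : Type*} {D : ι → ι → Prop} {S K : Finset ι}

/-- `K` is a kernel of the digraph `D` induced on `S`: an independent set that receives an arc from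
every other vertex. -/
def IsKernel (D : ι → ι → Prop) (S K : Finset ι) : Prop :=
  K ⊆ S ∧ (∀ i ∈ K, ∀ j ∈ K, ¬ D i j) ∧ ∀ i ∈ S, i ∉ K → ∃ j ∈ K, D i j

/-- `K` is a semikernel of the digraph `D` induced on `S`: an independent set such that every
vertex of `S` reached by an arc from `K` sends an arc back to `K`. -/
def IsSemikernel (D : ι → ι → Prop) (S K : Finset ι) : Prop :=
  K ⊆ S ∧ (∀ i ∈ K, ∀ j ∈ K, ¬ D i j) ∧ ∀ i ∈ K, ∀ j ∈ S, D i j → ∃ k ∈ K, D j k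

/-- `D` is kernel-perfect: every finite induced subdigraph has a kernel. -/
def IsKernelPerfect (D : ι → ι → Prop) : Prop :=
  ∀ S : Finset ι, ∃ K, IsKernel D S K

/-- The digraph `D` has no odd directed cycle, in a form that can be checked locally: no arc
increases `rank`, and the arcs that preserve it run between the two values of `side`. -/
def IsEvenlyRanked {ρ : Type*} [LT ρ] (D : ι → ι → Prop) (rank : ι → ρ) (side : ι → Bool) : Prop :=
  ∀ i j, D i j → rank j < rank i ∨ rank j = rank i ∧ side j ≠ side i

/-- Neumann-Lara's theorem. -/
theorem isKernelPerfect_of_forall_exists_isSemikernel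
    (hD : ∀ S : Finset ι, S.Nonempty → ∃ K, K.Nonempty ∧ IsSemikernel D S K) :
    IsKernelPerfect D := by
  classical
  intro S
  induction S using Finset.strongInduction with
  | H S ih =>
    obtain rfl | hS := S.eq_empty_or_nonempty
    · exact ⟨∅, by simp [IsKernel]⟩
    obtain ⟨K₀, ⟨k, hk⟩, hsub₀, hind₀, hback⟩ := hD S hS
    let T := {i ∈ S | i ∉ K₀ ∧ ∀ j ∈ K₀, ¬ D i j}
    have hTS : T ⊂ S :=
      (Finset.filter_ssubset (s := S)).2 ⟨k, hsub₀ hk, fun h => h.1 hk⟩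
    obtain ⟨K₁, hsub₁, hind₁, habs₁⟩ := ih T hTS
    have hT : ∀ {i}, i ∈ K₁ → i ∈ S ∧ i ∉ K₀ ∧ ∀ j ∈ K₀, ¬ D i j :=
      fun hi => Finset.mem_filter.1 (hsub₁ hi)
    refine ⟨K₀ ∪ K₁, Finset.union_subset hsub₀ fun i hi => (hT hi).1, fun i hi j hj hij => ?_,
      fun i hi hiK => ?_⟩
    · rcases Finset.mem_union.1 hi with hi | hi <;> rcases Finset.mem_union.1 hj with hj | hj
      · exact hind₀ i hi j hj hij
      · obtain ⟨k, hk, hjk⟩ := hback i hi j (hT hj).1 hij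
        exact (hT hj).2.2 k hk hjk
      · exact (hT hi).2.2 j hj hij
      · exact hind₁ i hi j hj hij
    · rw [Finset.mem_union, not_or] at hiK
      by_cases hiT : ∃ j ∈ K₀, D i j
      · obtain ⟨j, hj, hij⟩ := hiT
        exact ⟨j, Finset.mem_union_left _ hj, hij⟩
      · push Not at hiT
        obtain ⟨j, hj, hij⟩ := habs₁ i (Finset.mem_filter.2 ⟨hi, hiK.1, hiT⟩) hiK.2
        exact ⟨j, Finset.mem_union_right _ hj, hij⟩

variable {ρ : Type*} [LinearOrder ρ] {rank : ι → ρ} {side : ι → Bool}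

theorem IsEvenlyRanked.exists_isSemikernel (hD : IsEvenlyRanked D rank side) (hS : S.Nonempty) :
    ∃ K, K.Nonempty ∧ IsSemikernel D S K := by
  by_cases hsink : ∃ i ∈ S, ∀ j ∈ S, ¬ D i j
  · obtain ⟨i, hi, hout⟩ := hsink
    refine ⟨{i}, Finset.singleton_nonempty i, by simpa using hi, by simpa using hout i hi, ?_⟩
    simpa using fun j hj hij => absurd hij (hout j hj)
  push Not at hsink
  obtain ⟨m, hm, hmin⟩ := S.exists_min_image rank hS
  have harc : ∀ i ∈ S, rank i = rank m → ∀ j ∈ S, D i j → rank j = rank m ∧ side j ≠ side i := by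
    intro i _ him j hj hij
    rcases hD i j hij with h | h
    · exact absurd (hmin j hj) (not_le.2 (him ▸ h))
    · exact ⟨h.1.trans him, h.2⟩
  refine ⟨{i ∈ S | rank i = rank m ∧ side i = side m}, ⟨m, by simp [hm]⟩,
    Finset.filter_subset _ _, ?_, ?_⟩
  · simp only [Finset.mem_filter]
    rintro i ⟨hi, hir, his⟩ j ⟨hj, -, hjs⟩ hij
    exact (harc i hi hir j hj hij).2 (hjs.trans his.symm)
  · simp only [Finset.mem_filter]
    rintro i ⟨hi, hir, his⟩ j hj hij
    obtain ⟨hjr, hjs⟩ := harc i hi hir j hj hij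
    obtain ⟨k, hk, hjk⟩ := hsink j hj
    obtain ⟨hkr, hks⟩ := harc j hj hjr k hk hjk
    exact ⟨k, ⟨hk, hkr, by rw [Bool.eq_not.2 hks, Bool.eq_not.2 hjs, Bool.not_not, his]⟩, hjk⟩

theorem IsEvenlyRanked.isKernelPerfect (hD : IsEvenlyRanked D rank side) : IsKernelPerfect D :=
  isKernelPerfect_of_forall_exists_isSemikernel fun _ => hD.exists_isSemikernel

end Kernels

section ListColourings

open Finset

variable {ι α : Type*} {D : ι → ι → Prop} [DecidableRel D]

/-- A vertex outside the kernel that loses `x` from its list also loses an out-neighbour. -/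
theorem IsKernel.card_out_sdiff_lt_card_erase [DecidableEq ι] [DecidableEq α] {S K : Finset ι}
    {L : ι → Finset α} {x : α} (hK : IsKernel D {i ∈ S | x ∈ L i} K) {i : ι} (hi : i ∈ S \ K)
    (hL : #{j ∈ S | D i j} < #(L i)) : #{j ∈ S \ K | D i j} < #((L i).erase x) := by
  obtain ⟨hsub, -, habs⟩ := hK
  obtain ⟨hiS, hiK⟩ := mem_sdiff.1 hi
  have hout : {j ∈ S \ K | D i j} ⊆ {j ∈ S | D i j} := filter_subset_filter _ sdiff_subset
  by_cases hxi : x ∈ L i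
  · obtain ⟨j, hj, hij⟩ := habs i (mem_filter.2 ⟨hiS, hxi⟩) hiK
    have hjS : j ∈ S := (mem_filter.1 (hsub hj)).1
    have hlt : #{j ∈ S \ K | D i j} < #{j ∈ S | D i j} :=
      card_lt_card (hout.ssubset_of_mem_notMem (mem_filter.2 ⟨hjS, hij⟩) (by simp [hj]))
    rw [card_erase_of_mem hxi]
    exact hlt.trans_le (Nat.le_sub_one_of_lt hL)
  · rw [erase_eq_of_notMem hxi]
    exact (card_le_card hout).trans_lt hL

/-- The kernel method of Bondy, Boppana and Siegel: a colour `x` can be given to all vertices of a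
kernel of the set of vertices whose lists contain it. -/
theorem IsKernelPerfect.exists_listColouring [Nonempty α] (hD : IsKernelPerfect D) (S : Finset ι)
    (L : ι → Finset α) (hL : ∀ i ∈ S, #{j ∈ S | D i j} < #(L i)) :
    ∃ c : ι → α, (∀ i ∈ S, c i ∈ L i) ∧ ∀ i ∈ S, ∀ j ∈ S, D i j → c i ≠ c j := by
  classical
  induction S using Finset.strongInduction generalizing L with
  | H S ih =>
    obtain rfl | ⟨m, hm⟩ := S.eq_empty_or_nonempty
    · exact ⟨fun _ => Classical.arbitrary α, by simp⟩
    obtain ⟨x, hx⟩ : (L m).Nonempty := card_pos.1 (Nat.zero_lt_of_lt (hL m hm))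
    obtain ⟨K, hK⟩ := hD {i ∈ S | x ∈ L i}
    obtain ⟨hsub, hind, habs⟩ := id hK
    have hKne : K.Nonempty := by
      by_contra h
      rw [not_nonempty_iff_eq_empty] at h
      simpa [h] using habs m (mem_filter.2 ⟨hm, hx⟩)
    have hss : S \ K ⊂ S := sdiff_ssubset (hsub.trans (filter_subset _ _)) hKne
    obtain ⟨c, hcL, hc⟩ := ih (S \ K) hss (fun i => (L i).erase x) fun i hi =>
      hK.card_out_sdiff_lt_card_erase hi (hL i (mem_sdiff.1 hi).1)
    have hcL' : ∀ i ∈ S, i ∉ K → c i ≠ x ∧ c i ∈ L i := fun i hi hiK =>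
      mem_erase.1 (hcL i (mem_sdiff.2 ⟨hi, hiK⟩))
    refine ⟨fun i => if i ∈ K then x else c i, fun i hi => ?_, fun i hi j hj hij => ?_⟩
    · by_cases hiK : i ∈ K
      · simpa only [if_pos hiK] using (mem_filter.1 (hsub hiK)).2
      · simpa only [if_neg hiK] using (hcL' i hi hiK).2
    · by_cases hiK : i ∈ K <;> by_cases hjK : j ∈ K
      · exact absurd hij (hind i hiK j hjK)
      · simpa only [if_pos hiK, if_neg hjK] using (hcL' j hj hjK).1.symm
      · simpa only [if_neg hiK, if_pos hjK] using (hcL' i hi hiK).1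
      · simpa only [if_neg hiK, if_neg hjK] using
          hc i (mem_sdiff.2 ⟨hi, hiK⟩) j (mem_sdiff.2 ⟨hj, hjK⟩) hij

/-- If `A` and `B` share a colour, it can serve as both `a` and `b`. Otherwise a list of at most
`k` colours contains both entries of at most `k ^ 2 / 4` of the pairs in `A × B`. -/
theorem exists_pair_card_le_card_sdiff_add_one [DecidableEq α] {A B : Finset α} {T : Finset ι}
    {L : ι → Finset α} {k : ℕ} (hA : k ≤ #A) (hB : k ≤ #B) (hL : ∀ i ∈ T, #(L i) ≤ k)
    (hT : #T * (k ^ 2 / 4) < k ^ 2) :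
    ∃ a ∈ A, ∃ b ∈ B, ∀ i ∈ T, #(L i) ≤ #(L i \ {a, b}) + 1 := by
  classical
  by_cases hAB : Disjoint A B
  · let bad := T.biUnion fun i => (A ∩ L i) ×ˢ (B ∩ L i)
    have hbad : ∀ i ∈ T, #((A ∩ L i) ×ˢ (B ∩ L i)) ≤ k ^ 2 / 4 := by
      intro i hi
      have hsum : #(A ∩ L i) + #(B ∩ L i) ≤ k := by
        rw [← card_union_of_disjoint (hAB.mono inter_subset_left inter_subset_left)]
        exact (card_le_card (union_subset inter_subset_right inter_subset_right)).trans (hL i hi)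
      rw [card_product, Nat.le_div_iff_mul_le (by norm_num), mul_comm, ← mul_assoc]
      exact (four_mul_le_sq_add _ _).trans (Nat.pow_le_pow_left hsum 2)
    have hcard : #bad < #(A ×ˢ B) := calc
      #bad ≤ #T * (k ^ 2 / 4) := card_biUnion_le_card_mul _ _ _ hbad
      _ < k ^ 2 := hT
      _ ≤ #(A ×ˢ B) := by rw [card_product, sq]; exact Nat.mul_le_mul hA hB
    obtain ⟨⟨a, b⟩, hab, hgood⟩ := exists_mem_notMem_of_card_lt_card hcard
    obtain ⟨ha, hb⟩ := mem_product.1 hab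
    refine ⟨a, ha, b, hb, fun i hi => ?_⟩
    have hmiss : a ∉ L i ∨ b ∉ L i := by
      by_contra! h
      exact hgood (mem_biUnion.2 ⟨i, hi, by simp [ha, hb, h]⟩)
    rcases hmiss with h | h
    · rw [sdiff_insert_of_notMem h]
      exact card_le_card_sdiff_add_card
    · rw [pair_comm, sdiff_insert_of_notMem h]
      exact card_le_card_sdiff_add_card
  · obtain ⟨a, ha, hb⟩ := not_disjoint_iff.1 hAB
    refine ⟨a, ha, a, hb, fun i _ => ?_⟩
    rw [pair_eq_singleton]
    exact card_le_card_sdiff_add_card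

theorem IsKernelPerfect.exists_listColouring_of_precolouring [Fintype ι] [DecidableEq ι]
    [DecidableEq α] (hD : IsKernelPerfect D) {R : Finset ι} (hR : ∀ i ∈ R, ∀ j, ¬ D i j)
    {L : ι → Finset α} {c₀ : ι → α} (hc₀ : ∀ i ∈ R, c₀ i ∈ L i)
    (hL : ∀ i ∉ R, #{j ∈ Rᶜ | D i j} < #(L i \ image c₀ {j ∈ R | D i j})) :
    ∃ c : ι → α, (∀ i, c i ∈ L i) ∧ ∀ i j, D i j → c i ≠ c j := by
  obtain hι | ⟨⟨m⟩⟩ := isEmpty_or_nonempty ι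
  · exact ⟨isEmptyElim, isEmptyElim, isEmptyElim⟩
  have : Nonempty α := ⟨c₀ m⟩
  obtain ⟨c, hcL, hc⟩ := hD.exists_listColouring Rᶜ
    (fun i => L i \ image c₀ {j ∈ R | D i j}) fun i hi => hL i (mem_compl.1 hi)
  refine ⟨fun i => if i ∈ R then c₀ i else c i, fun i => ?_, fun i j hij => ?_⟩
  · by_cases hi : i ∈ R
    · simpa only [if_pos hi] using hc₀ i hi
    · simpa only [if_neg hi] using (mem_sdiff.1 (hcL i (mem_compl.2 hi))).1
  · have hi : i ∉ R := fun hi => hR i hi j hij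
    have hci := hcL i (mem_compl.2 hi)
    by_cases hj : j ∈ R
    · simp only [if_neg hi, if_pos hj]
      intro h
      exact (mem_sdiff.1 hci).2 (h ▸ mem_image_of_mem c₀ (mem_filter.2 ⟨hj, hij⟩))
    · simpa only [if_neg hi, if_neg hj] using
        hc i (mem_compl.2 hi) j (mem_compl.2 hj) hij

/-- The sinks `u` and `w` can be coloured so that each of the few vertices whose out-degree equals
the size of the lists loses two out-neighbours but at most one colour. -/
theorem IsKernelPerfect.exists_listColouring_of_two_sinks [Fintype ι]
    (hD : IsKernelPerfect D) {u w : ι} (hu : ∀ j, ¬ D u j) (hw : ∀ j, ¬ D w j)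
    (huw : u ≠ w) {L : ι → Finset α} {k : ℕ} (hL : ∀ i, #(L i) = k)
    (hle : ∀ i, #{j | D i j} ≤ k) (htight : ∀ i, #{j | D i j} = k → D i u ∧ D i w)
    (hfew : #{i | #{j | D i j} = k} * (k ^ 2 / 4) < k ^ 2) :
    ∃ c : ι → α, (∀ i, c i ∈ L i) ∧ ∀ i j, D i j → c i ≠ c j := by
  classical
  obtain ⟨a, ha, b, hb, hab⟩ := exists_pair_card_le_card_sdiff_add_one
    (hL u).ge (hL w).ge (fun i _ => (hL i).le) hfew
  let c₀ : ι → α := fun i => if i = u then a else b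
  refine hD.exists_listColouring_of_precolouring (R := {u, w}) (c₀ := c₀) (by simp [hu, hw])
    (by simp [c₀, ha, hb, huw.symm]) fun i _ => ?_
  have hsplit : #{j ∈ ({u, w} : Finset ι) | D i j} + #{j ∈ ({u, w} : Finset ι)ᶜ | D i j} =
      #{j | D i j} := by
    rw [← card_union_of_disjoint (disjoint_filter_filter disjoint_compl_right), ← filter_union,
      union_compl]
  obtain hlt | heq := (hle i).lt_or_eq
  · calc #{j ∈ ({u, w} : Finset ι)ᶜ | D i j}
        < #(L i) - #{j ∈ ({u, w} : Finset ι) | D i j} := by rw [hL i]; omega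
      _ ≤ #(L i) - #(image c₀ {j ∈ ({u, w} : Finset ι) | D i j}) :=
        Nat.sub_le_sub_left card_image_le _
      _ ≤ #(L i \ image c₀ {j ∈ ({u, w} : Finset ι) | D i j}) := le_card_sdiff _ _
  · obtain ⟨hiu, hiw⟩ := htight i heq
    have hpair : {j ∈ ({u, w} : Finset ι) | D i j} = {u, w} := by simp [filter_eq_self, hiu, hiw]
    have himage : image c₀ {u, w} = {a, b} := by simp [c₀, image_insert, huw.symm]
    have hone := hab i (by simpa using heq)
    rw [hL i] at hone
    rw [hpair, card_pair huw] at hsplit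
    rw [hpair, himage]
    omega

end ListColourings

section Paths

open SimpleGraph

variable {V : Type*} {G : SimpleGraph V} {c : G.EdgeLabeling ℕ} {u v w x y : V}

theorem isRainbow_nil : IsRainbow c (Walk.nil : G.Walk u u) :=
  fun e he => absurd he (by simp)

theorem IsRainbow.cons {h : G.Adj u w} {p : G.Walk w v} (hp : IsRainbow c p)
    (hc : ∀ e : G.edgeSet, (e : Sym2 V) ∈ p.edges → c ⟨s(u, w), h⟩ ≠ c e) :
    IsRainbow c (.cons h p) := by
  have hset : {e : G.edgeSet | (e : Sym2 V) ∈ (Walk.cons h p).edges} =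
      insert ⟨s(u, w), h⟩ {e : G.edgeSet | (e : Sym2 V) ∈ p.edges} := by
    ext e
    simp [Subtype.ext_iff]
  rw [IsRainbow, hset]
  rintro e (rfl | he) f (rfl | hf) hef
  · rfl
  · exact absurd hef (hc f hf)
  · exact absurd hef.symm (hc e he)
  · exact hp he hf hef

theorem isRainbow_toWalk (h : G.Adj u v) : IsRainbow c h.toWalk :=
  isRainbow_nil.cons (by simp)

theorem isRainbow_of_two_edges {h₁ : G.Adj u w} {h₂ : G.Adj w v}
    (hc : c ⟨s(u, w), h₁⟩ ≠ c ⟨s(w, v), h₂⟩) : IsRainbow c (.cons h₁ (.cons h₂ .nil)) := by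
  refine (isRainbow_toWalk h₂).cons ?_
  rintro ⟨e, he⟩ hmem
  obtain rfl : e = s(w, v) := by simpa using hmem
  exact hc

theorem isRainbow_of_three_edges {h₁ : G.Adj u x} {h₂ : G.Adj x y} {h₃ : G.Adj y v}
    (hc₁₂ : c ⟨s(u, x), h₁⟩ ≠ c ⟨s(x, y), h₂⟩) (hc₁₃ : c ⟨s(u, x), h₁⟩ ≠ c ⟨s(y, v), h₃⟩)
    (hc₂₃ : c ⟨s(x, y), h₂⟩ ≠ c ⟨s(y, v), h₃⟩) :
    IsRainbow c (.cons h₁ (.cons h₂ (.cons h₃ .nil))) := by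
  refine (isRainbow_of_two_edges hc₂₃).cons ?_
  rintro ⟨e, he⟩ hmem
  obtain rfl | rfl : e = s(x, y) ∨ e = s(y, v) := by simpa using hmem
  exacts [hc₁₂, hc₁₃]

theorem IsRainbow.length_le {k : ℕ} (hc : ∀ e, c e < k) {p : G.Walk u v} (hr : IsRainbow c p)
    (hp : p.IsPath) : p.length ≤ k := by
  classical
  have hmem : ∀ e : {e // e ∈ p.edges.toFinset}, e.1 ∈ p.edges := fun e => List.mem_toFinset.1 e.2
  calc p.length = p.edges.toFinset.attach.card := by
        rw [Finset.card_attach, List.toFinset_card_of_nodup hp.edges_nodup, Walk.length_edges]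
    _ ≤ (Finset.range k).card := by
        refine Finset.card_le_card_of_injOn
          (fun e => c ⟨e.1, p.edges_subset_edgeSet (hmem e)⟩)
          (fun e _ => Finset.mem_coe.2 (Finset.mem_range.2 (hc _))) fun e _ f _ hef => ?_
        exact Subtype.ext (congrArg (fun e : G.edgeSet => (e : Sym2 V))
          (@hr ⟨e, _⟩ (hmem e) ⟨f, _⟩ (hmem f) hef))
    _ = k := Finset.card_range k

theorem IsRainbow.colour_ne {p : G.Walk u v} (hr : IsRainbow c p) (hlen : p.length ≤ 2)
    (h₁ : G.Adj u w) (h₂ : G.Adj w v) (huv : u ≠ v) (hadj : ¬ G.Adj u v)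
    (huniq : ∀ x, G.Adj u x → G.Adj x v → x = w) : c ⟨s(u, w), h₁⟩ ≠ c ⟨s(w, v), h₂⟩ := by
  rcases p with _ | ⟨(h : G.Adj u _), _ | ⟨h', _ | ⟨h'', q⟩⟩⟩
  · exact absurd rfl huv
  · exact absurd h hadj
  · obtain rfl := huniq _ h h'
    intro hc
    have hedge : s(u, _) = s(_, v) := congrArg Subtype.val
      (@hr ⟨s(u, _), h⟩ (by simp) ⟨s(_, v), h'⟩ (by simp) hc)
    simp [huv, h.ne] at hedge
  · simp at hlen

end Paths

section EdgeColourings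

open SimpleGraph

variable {V K : Type*} {G : SimpleGraph V}

/-- A proper edge-colouring: any two edges `uw` and `wv` that share a vertex have different
colours. -/
def IsProperEdgeColouring (c : G.EdgeLabeling K) : Prop :=
  ∀ ⦃u w v⦄ (h₁ : G.Adj u w) (h₂ : G.Adj w v), u ≠ v → c ⟨s(u, w), h₁⟩ ≠ c ⟨s(w, v), h₂⟩

theorem IsProperEdgeColouring.toFin {c : G.EdgeLabeling ℕ} {k : ℕ} (hc : IsProperEdgeColouring c)
    (hlt : ∀ e, c e < k) :
    IsProperEdgeColouring (G := G) fun e => (⟨c e, hlt e⟩ : Fin k) :=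
  fun _ _ _ h₁ h₂ huv heq => hc h₁ h₂ huv (congrArg Fin.val heq)

theorem IsProperEdgeColouring.degree_le [Fintype K] {c : G.EdgeLabeling K}
    (hc : IsProperEdgeColouring c) (v : V) [Fintype (G.neighborSet v)] :
    G.degree v ≤ Fintype.card K := by
  rw [← card_neighborSet_eq_degree]
  refine Fintype.card_le_of_injective
    (fun w : G.neighborSet v => c ⟨s(w.1, v), G.adj_symm w.2⟩) fun u w huw => ?_
  by_contra hne
  refine hc (G.adj_symm u.2) w.2 (fun h => hne (Subtype.ext h)) (huw.trans ?_)
  exact congrArg c (Subtype.ext Sym2.eq_swap)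

variable [Fintype V] [DecidableRel G.Adj] {n k : ℕ}

theorem not_adj_of_isSRGWith (hG : G.IsSRGWith n k 0 1) {u w v : V} (h₁ : G.Adj u w)
    (h₂ : G.Adj w v) : ¬ G.Adj u v := by
  intro h
  have hempty := Fintype.card_eq_zero_iff.1 (hG.of_adj u v h)
  exact hempty.elim ⟨w, h₁, h₂.symm⟩

theorem existsUnique_adj_adj_of_isSRGWith (hG : G.IsSRGWith n k 0 1) {u v : V} (huv : u ≠ v)
    (hadj : ¬ G.Adj u v) : ∃! w, G.Adj u w ∧ G.Adj w v := by
  obtain ⟨⟨w, hw⟩, huniq⟩ := Fintype.card_eq_one_iff.1 (hG.of_not_adj huv hadj)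
  exact ⟨w, ⟨hw.1, G.adj_symm hw.2⟩, fun x hx =>
    congrArg Subtype.val (huniq ⟨x, hx.1, G.adj_symm hx.2⟩)⟩

variable {c : G.EdgeLabeling ℕ}

theorem isProperEdgeColouring_of_isRainbow (hG : G.IsSRGWith n k 0 1)
    (hc : ∀ u v, ∃ p : G.Walk u v, p.length ≤ 2 ∧ IsRainbow c p) :
    IsProperEdgeColouring c := by
  intro u w v h₁ h₂ huv
  obtain ⟨p, hlen, hp⟩ := hc u v
  have hadj := not_adj_of_isSRGWith hG h₁ h₂
  exact hp.colour_ne hlen h₁ h₂ huv hadj fun x hux hxv =>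
    (existsUnique_adj_adj_of_isSRGWith hG huv hadj).unique ⟨hux, hxv⟩ ⟨h₁, h₂⟩

theorem RainbowConnected.isProperEdgeColouring (hc : RainbowConnected c)
    (hG : G.IsSRGWith n k 0 1) (hlt : ∀ e, c e < 2) : IsProperEdgeColouring c :=
  isProperEdgeColouring_of_isRainbow hG fun u v =>
    let ⟨p, hp, hr⟩ := hc u v
    ⟨p, hr.length_le hlt hp, hr⟩

theorem dist_le_two_of_isSRGWith (hG : G.IsSRGWith n k 0 1) (u v : V) : G.dist u v ≤ 2 := by
  by_cases huv : u = v
  · simp [huv]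
  by_cases hadj : G.Adj u v
  · simp [dist_eq_one_iff_adj.2 hadj]
  · obtain ⟨w, h₁, h₂⟩ := (existsUnique_adj_adj_of_isSRGWith hG huv hadj).exists
    exact dist_le (.cons h₁ (.cons h₂ .nil))

theorem stronglyRainbowConnected_iff_isProperEdgeColouring (hG : G.IsSRGWith n k 0 1) :
    StronglyRainbowConnected c ↔ IsProperEdgeColouring c := by
  refine ⟨fun hc => isProperEdgeColouring_of_isRainbow hG fun u v => ?_, fun hc u v => ?_⟩
  · obtain ⟨p, -, hlen, hr⟩ := hc u v
    exact ⟨p, hlen ▸ dist_le_two_of_isSRGWith hG u v, hr⟩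
  by_cases huv : u = v
  · subst huv
    exact ⟨.nil, .nil, by simp, isRainbow_nil⟩
  by_cases hadj : G.Adj u v
  · exact ⟨hadj.toWalk, by simp [huv], by simp [dist_eq_one_iff_adj.2 hadj], isRainbow_toWalk hadj⟩
  obtain ⟨w, h₁, h₂⟩ := (existsUnique_adj_adj_of_isSRGWith hG huv hadj).exists
  let p : G.Walk u v := .cons h₁ (.cons h₂ .nil)
  have hdist : G.dist u v = 2 := by
    have hpos := p.reachable.pos_dist_of_ne huv
    have hne : G.dist u v ≠ 1 := mt dist_eq_one_iff_adj.1 hadj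
    have := dist_le_two_of_isSRGWith hG u v
    omega
  exact ⟨p, by simp [p, h₁.ne, h₂.ne, huv], hdist.symm, isRainbow_of_two_edges (hc h₁ h₂ huv)⟩

end EdgeColourings

section EdgeListAssignments

variable {V : Type*} {G : SimpleGraph V} {r k : ℕ}

theorem IsEdgeListAssignment.exists_finset {L : G.edgeSet → Set ℕ}
    (hL : IsEdgeListAssignment r L) :
    ∃ L' : G.edgeSet → Finset ℕ, ∀ e, (L' e : Set ℕ) ⊆ L e ∧ (L' e).card = r := by
  choose M hML hM using fun e => Set.exists_subset_encard_eq (hL e)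
  have hfin : ∀ e, (M e).Finite := fun e => Set.finite_of_encard_eq_coe (hM e)
  refine ⟨fun e => (hfin e).toFinset, fun e => ⟨by simpa using hML e, ?_⟩⟩
  rw [← Nat.cast_inj (R := ℕ∞), ← (hfin e).encard_eq_coe_toFinset_card, hM e]

theorem isEdgeListAssignment_Iio (h : r ≤ k) :
    IsEdgeListAssignment r (fun _ : G.edgeSet => Set.Iio k) := by
  intro e
  rw [← Finset.coe_Iio, Set.encard_coe_eq_coe_finsetCard, Nat.card_Iio]
  exact_mod_cast h

end EdgeListAssignments

section SpokedPentagons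

/-- The pattern of colours on the spokes of a pentagon in a proper edge-colouring with three
colours: two consecutive spokes `i` and `i + 1` have colours of their own and the other three share
the remaining colour `x`. -/
def IsSpokePattern (s : Fin 5 → Fin 3) : Prop :=
  ∃ i x, s i ≠ x ∧ s (i + 1) ≠ x ∧ s i ≠ s (i + 1) ∧ s (i + 2) = x ∧ s (i + 3) = x ∧ s (i + 4) = x

instance : DecidablePred IsSpokePattern := fun s => by
  unfold IsSpokePattern
  infer_instance

theorem isSpokePattern_of_cycle {o s : Fin 5 → Fin 3} (ho : ∀ i, o i ≠ o (i + 1))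
    (hs : ∀ i, s i ≠ o i) (hs' : ∀ i, s (i + 1) ≠ o i) : IsSpokePattern s := by
  have hthird : ∀ x y z : Fin 3, x ≠ y → z ≠ x → z ≠ y → z = -(x + y) := by decide
  have hs_eq : s = fun i => -(o (i - 1) + o i) := by
    ext1 i
    have ho := ho (i - 1)
    have hs' := hs' (i - 1)
    rw [sub_add_cancel] at ho hs'
    exact hthird _ _ _ ho hs' (hs i)
  have hpattern : ∀ o : Fin 5 → Fin 3, (∀ i, o i ≠ o (i + 1)) →
      IsSpokePattern fun i => -(o (i - 1) + o i) := by
    decide +kernel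
  exact hs_eq ▸ hpattern o ho

/-- The indices `0, 2, 4, 1, 3` run through the spokes in the order in which they meet the inner
pentagon of the Petersen graph. Spokes consecutive on one pentagon are not consecutive on the
other. -/
theorem IsSpokePattern.not_isSpokePattern_two_mul : ∀ {s : Fin 5 → Fin 3}, IsSpokePattern s →
    ¬ IsSpokePattern fun i => s (2 * i) := by
  decide +kernel

theorem IsProperEdgeColouring.isSpokePattern {V : Type*} {G : SimpleGraph V}
    {c : G.EdgeLabeling (Fin 3)} (hc : IsProperEdgeColouring c) {v w : Fin 5 → V}
    (hvv : ∀ i, G.Adj (v i) (v (i + 1))) (hwv : ∀ i, G.Adj (w i) (v i))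
    (hv : ∀ i, v i ≠ v (i + 1 + 1)) (hw : ∀ i, w i ≠ v (i + 1)) (hw' : ∀ i, w (i + 1) ≠ v i) :
    IsSpokePattern fun i => c ⟨s(w i, v i), hwv i⟩ := by
  refine isSpokePattern_of_cycle (o := fun i => c ⟨s(v i, v (i + 1)), hvv i⟩)
    (fun i => hc (hvv i) (hvv (i + 1)) (hv i)) (fun i => hc (hwv i) (hvv i) (hw i)) fun i h => ?_
  refine hc (hwv (i + 1)) (G.adj_symm (hvv i)) (hw' i) (h.trans ?_)
  exact congrArg c (Subtype.ext Sym2.eq_swap)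

end SpokedPentagons

section Petersen

instance : DecidableRel petersenGraph.Adj := fun s t =>
  inferInstanceAs (Decidable (Disjoint s.1 t.1))

theorem petersenGraph_isSRGWith : petersenGraph.IsSRGWith 10 3 0 1 where
  card := by decide +kernel
  regular := by unfold SimpleGraph.IsRegularOfDegree; decide +kernel
  of_adj := by decide +kernel
  of_not_adj := by unfold Pairwise; decide +kernel

/-- The two-element set `{a, b}` as a vertex of the Petersen graph. -/
def petersenVertex (a b : Fin 5) (h : a ≠ b := by decide) :
    {s : Finset (Fin 5) // s.card = 2} :=
  ⟨{a, b}, Finset.card_pair h⟩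

/-- The vertices of the outer pentagon of the Petersen graph. -/
def outerVertex (i : Fin 5) : {s : Finset (Fin 5) // s.card = 2} :=
  petersenVertex (2 * i) (2 * i + 1) (by revert i; decide)

/-- The vertices of the inner pentagram of the Petersen graph: `innerVertex i` is adjacent to
`outerVertex i` and to `innerVertex (i + 2)`. -/
def innerVertex (i : Fin 5) : {s : Finset (Fin 5) // s.card = 2} :=
  petersenVertex (2 * i + 2) (2 * i + 4) (by revert i; decide)

theorem not_isProperEdgeColouring_petersenGraph (c : petersenGraph.EdgeLabeling (Fin 3)) :
    ¬ IsProperEdgeColouring c := by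
  intro hc
  have hspoke : ∀ i, petersenGraph.Adj (innerVertex i) (outerVertex i) := by decide +kernel
  have houter : IsSpokePattern fun i => c ⟨s(innerVertex i, outerVertex i), hspoke i⟩ :=
    hc.isSpokePattern (by decide +kernel) hspoke (by decide +kernel) (by decide +kernel)
      (by decide +kernel)
  have hinner : IsSpokePattern fun i =>
      c ⟨s(outerVertex (2 * i), innerVertex (2 * i)), (hspoke (2 * i)).symm⟩ :=
    hc.isSpokePattern (v := fun i => innerVertex (2 * i)) (w := fun i => outerVertex (2 * i))
      (by decide +kernel) (fun i => (hspoke (2 * i)).symm) (by decide +kernel) (by decide +kernel)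
      (by decide +kernel)
  simp only [Sym2.eq_swap (a := outerVertex _)] at hinner
  exact houter.not_isSpokePattern_two_mul hinner

/-- The end vertices of the edges of the Petersen graph. With `v₀, …, v₇` the `8`-cycle
`01, 34, 02, 14, 03, 12, 04, 23` and `p = 13`, `q = 24` the two vertices outside it, edge `i ≤ 7`
is `vᵢvᵢ₊₁`, edges `8` and `9` are the chords `v₁v₅` and `v₃v₇`, edges `10` to `13` are `pv₂`,
`pv₆`, `qv₀` and `qv₄`, and edge `14` is `pq`. -/
def petersenEdgeEnds : Fin 15 →
    {s : Finset (Fin 5) // s.card = 2} × {s : Finset (Fin 5) // s.card = 2} :=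
  ![(petersenVertex 0 1, petersenVertex 3 4), (petersenVertex 3 4, petersenVertex 0 2),
    (petersenVertex 0 2, petersenVertex 1 4), (petersenVertex 1 4, petersenVertex 0 3),
    (petersenVertex 0 3, petersenVertex 1 2), (petersenVertex 1 2, petersenVertex 0 4),
    (petersenVertex 0 4, petersenVertex 2 3), (petersenVertex 2 3, petersenVertex 0 1),
    (petersenVertex 3 4, petersenVertex 1 2), (petersenVertex 1 4, petersenVertex 2 3),
    (petersenVertex 1 3, petersenVertex 0 2), (petersenVertex 1 3, petersenVertex 0 4),
    (petersenVertex 2 4, petersenVertex 0 1), (petersenVertex 2 4, petersenVertex 0 3),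
    (petersenVertex 1 3, petersenVertex 2 4)]

theorem petersenEdgeEnds_adj (i : Fin 15) :
    petersenGraph.Adj (petersenEdgeEnds i).1 (petersenEdgeEnds i).2 := by
  revert i
  decide +kernel

theorem bijective_petersenEdgeEnds : Function.Bijective fun i : Fin 15 =>
    (⟨s((petersenEdgeEnds i).1, (petersenEdgeEnds i).2), petersenEdgeEnds_adj i⟩ :
      petersenGraph.edgeSet) := by
  have hinj : ∀ i j, s((petersenEdgeEnds i).1, (petersenEdgeEnds i).2) =
      s((petersenEdgeEnds j).1, (petersenEdgeEnds j).2) → i = j := by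
    decide +kernel
  have hsurj : ∀ u v, petersenGraph.Adj u v →
      ∃ i, s((petersenEdgeEnds i).1, (petersenEdgeEnds i).2) = s(u, v) := by
    decide +kernel
  refine ⟨fun i j hij => hinj i j (congrArg Subtype.val hij), ?_⟩
  rintro ⟨⟨u, v⟩, he⟩
  obtain ⟨i, hi⟩ := hsurj u v he
  exact ⟨i, Subtype.ext hi⟩

/-- The enumeration of the edges of the Petersen graph by `petersenEdgeEnds`. -/
noncomputable def petersenEdge : Fin 15 ≃ petersenGraph.edgeSet :=
  Equiv.ofBijective _ bijective_petersenEdgeEnds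

/-- Two edges of the Petersen graph are joined by an arc of the digraph with out-neighbourhoods
`out` on their indices. -/
def Linked (out : Fin 15 → Finset (Fin 15)) (e f : Sym2 {s : Finset (Fin 5) // s.card = 2}) :
    Prop :=
  ∃ i, s((petersenEdgeEnds i).1, (petersenEdgeEnds i).2) = e ∧
    ∃ j, s((petersenEdgeEnds j).1, (petersenEdgeEnds j).2) = f ∧ (j ∈ out i ∨ i ∈ out j)

instance (out : Fin 15 → Finset (Fin 15)) : DecidableRel (Linked out) := fun e f => by
  unfold Linked
  infer_instance

theorem exists_isListEdgeColouring_of_out {out : Fin 15 → Finset (Fin 15)}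
    {L : petersenGraph.edgeSet → Set ℕ} {c : Fin 15 → ℕ} (hcL : ∀ i, c i ∈ L (petersenEdge i))
    (hc : ∀ i j, j ∈ out i → c i ≠ c j) :
    ∃ c' : petersenGraph.EdgeLabeling ℕ, IsListEdgeColouring L c' ∧
      ∀ e f : petersenGraph.edgeSet, Linked out e f → c' e ≠ c' f := by
  refine ⟨fun e => c (petersenEdge.symm e), fun e => ?_, ?_⟩
  · simpa only [Equiv.apply_symm_apply] using hcL (petersenEdge.symm e)
  · rintro e f ⟨i, hi, j, hj, hij⟩
    obtain rfl : petersenEdge i = e := Subtype.ext hi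
    obtain rfl : petersenEdge j = f := Subtype.ext hj
    simp only [Equiv.symm_apply_apply]
    exact hij.elim (hc i j) fun hji => (hc j i hji).symm

/-- An orientation of the line graph of the Petersen graph, given by out-neighbourhoods. The edges
of the `8`-cycle form a directed cycle and send arcs to the edges outside it, whose arcs among
themselves go down in the order `8, 9, 14, 10, 12, 11, 13`. -/
def lineGraphOut : Fin 15 → Finset (Fin 15) :=
  ![{1, 8, 12}, {2, 8, 10}, {3, 10, 9}, {4, 9, 13}, {5, 13, 8}, {6, 8, 11}, {7, 11, 9}, {0, 9, 12},
    ∅, ∅, {14}, {14, 10}, {14}, {14, 12}, ∅]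

theorem linked_lineGraphOut : ∀ {u w v}, petersenGraph.Adj u w → petersenGraph.Adj w v → u ≠ v →
    Linked lineGraphOut s(u, w) s(w, v) := by
  decide +kernel

theorem isEvenlyRanked_lineGraphOut : IsEvenlyRanked (fun i j => j ∈ lineGraphOut i)
    ![4, 4, 4, 4, 4, 4, 4, 4, 0, 0, 2, 3, 2, 3, 1] (fun i => i.val % 2 = 0) := by
  unfold IsEvenlyRanked
  decide +kernel

/-- A digraph on the edges of the Petersen graph whose arcs express that all pairs of vertices are
joined by rainbow paths. It has an arc between any two adjacent edges except for six pairs, whose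
geodesics are replaced by the detours `v₅v₁v₂p`, `v₅v₆v₇v₃`, `pv₂v₃v₇`, `v₃v₇v₀v₁`, `v₇v₃v₄q` and
`qv₄v₅v₁`. The end edges of a detour are joined by an arc as well; one of the two always is the
chord `8` or `9`. -/
def detourOut : Fin 15 → Finset (Fin 15) :=
  ![{1, 8, 9}, {10, 8}, {3, 9}, {13, 9}, {5, 8}, {6, 8, 9}, {7, 9}, {0, 9},
    ∅, ∅, {2, 8, 9}, {10, 14}, {13, 14}, {4, 8, 9}, {10, 13}]

theorem exists_linked_detourOut : ∀ {u v}, u ≠ v → ¬ petersenGraph.Adj u v →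
    (∃ w, petersenGraph.Adj u w ∧ petersenGraph.Adj w v ∧ Linked detourOut s(u, w) s(w, v)) ∨
    ∃ x, petersenGraph.Adj u x ∧ ∃ y, petersenGraph.Adj x y ∧ petersenGraph.Adj y v ∧
      Linked detourOut s(u, x) s(x, y) ∧ Linked detourOut s(u, x) s(y, v) ∧
      Linked detourOut s(x, y) s(y, v) := by
  decide +kernel

theorem isEvenlyRanked_detourOut : IsEvenlyRanked (fun i j => j ∈ detourOut i)
    ![1, 1, 1, 1, 1, 1, 1, 1, 0, 0, 1, 3, 3, 1, 2]
    (fun i => i ∈ ({0, 3, 4, 6, 10} : Finset (Fin 15))) := by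
  unfold IsEvenlyRanked
  decide +kernel

theorem rainbowConnected_of_detourOut {c : petersenGraph.EdgeLabeling ℕ}
    (hc : ∀ e f : petersenGraph.edgeSet, Linked detourOut e f → c e ≠ c f) :
    RainbowConnected c := by
  intro u v
  by_cases huv : u = v
  · subst huv
    exact ⟨.nil, .nil, isRainbow_nil⟩
  by_cases hadj : petersenGraph.Adj u v
  · exact ⟨hadj.toWalk, by simp [huv], isRainbow_toWalk hadj⟩
  obtain ⟨w, h₁, h₂, h₁₂⟩ | ⟨x, h₁, y, h₂, h₃, h₁₂, h₁₃, h₂₃⟩ := exists_linked_detourOut huv hadj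
  · exact ⟨.cons h₁ (.cons h₂ .nil), by simp [h₁.ne, h₂.ne, huv],
      isRainbow_of_two_edges (hc _ _ h₁₂)⟩
  · have huy : u ≠ y := fun h => hadj (h ▸ h₃)
    have hxv : x ≠ v := fun h => hadj (h ▸ h₁)
    exact ⟨.cons h₁ (.cons h₂ (.cons h₃ .nil)), by simp [h₁.ne, h₂.ne, h₃.ne, huv, huy, hxv],
      isRainbow_of_three_edges (hc _ _ h₁₂) (hc _ _ h₁₃)
        (hc _ _ h₂₃)⟩

theorem exists_rainbowConnected_listEdgeColouring {L : petersenGraph.edgeSet → Set ℕ}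
    (hL : IsEdgeListAssignment 3 L) :
    ∃ c : petersenGraph.EdgeLabeling ℕ, IsListEdgeColouring L c ∧ RainbowConnected c := by
  obtain ⟨L', hL'⟩ := hL.exists_finset
  obtain ⟨c, hcL, hc⟩ := isEvenlyRanked_detourOut.isKernelPerfect.exists_listColouring_of_two_sinks
    (u := 8) (w := 9) (k := 3) (L := fun i => L' (petersenEdge i)) (by decide) (by decide)
    (by decide) (fun i => (hL' _).2) (by decide) (by decide) (by decide)
  obtain ⟨c', hc'L, hc'⟩ := exists_isListEdgeColouring_of_out (fun i => (hL' _).1 (hcL i)) hc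
  exact ⟨c', hc'L, rainbowConnected_of_detourOut hc'⟩

theorem exists_isProperEdgeColouring_listEdgeColouring {L : petersenGraph.edgeSet → Set ℕ}
    (hL : IsEdgeListAssignment 4 L) :
    ∃ c : petersenGraph.EdgeLabeling ℕ, IsListEdgeColouring L c ∧ IsProperEdgeColouring c := by
  obtain ⟨L', hL'⟩ := hL.exists_finset
  have hdeg : ∀ i, (Finset.univ.filter fun j => j ∈ lineGraphOut i).card < 4 := by decide
  obtain ⟨c, hcL, hc⟩ := isEvenlyRanked_lineGraphOut.isKernelPerfect.exists_listColouring
    Finset.univ (fun i => L' (petersenEdge i)) fun i _ => (hL' _).2 ▸ hdeg i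
  obtain ⟨c', hc'L, hc'⟩ := exists_isListEdgeColouring_of_out (out := lineGraphOut)
    (fun i => (hL' _).1 (hcL i (Finset.mem_univ i)))
    fun i j => hc i (Finset.mem_univ i) j (Finset.mem_univ j)
  exact ⟨c', hc'L, fun u w v h₁ h₂ huv => hc' _ _ (linked_lineGraphOut h₁ h₂ huv)⟩

theorem listRainbowConnectionNumber_petersenGraph :
    listRainbowConnectionNumber petersenGraph = 3 := by
  refine IsLeast.csInf_eq
    ⟨⟨by norm_num, fun L hL => exists_rainbowConnected_listEdgeColouring hL⟩, ?_⟩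
  rintro r ⟨-, hr⟩
  by_contra! hlt
  obtain ⟨c, hc₂, hc⟩ := hr _ (isEdgeListAssignment_Iio (k := 2) (by omega))
  have hdeg := ((hc.isProperEdgeColouring petersenGraph_isSRGWith hc₂).toFin hc₂).degree_le
    (petersenVertex 0 1)
  rw [petersenGraph_isSRGWith.regular, Fintype.card_fin] at hdeg
  omega

theorem listStrongRainbowConnectionNumber_petersenGraph :
    listStrongRainbowConnectionNumber petersenGraph = 4 := by
  have hiff := fun c : petersenGraph.EdgeLabeling ℕ =>
    stronglyRainbowConnected_iff_isProperEdgeColouring (c := c) petersenGraph_isSRGWith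
  simp only [listStrongRainbowConnectionNumber, hiff]
  refine IsLeast.csInf_eq
    ⟨⟨by norm_num, fun L hL => exists_isProperEdgeColouring_listEdgeColouring hL⟩, ?_⟩
  rintro r ⟨-, hr⟩
  by_contra! hlt
  obtain ⟨c, hc₃, hc⟩ := hr _ (isEdgeListAssignment_Iio (k := 3) (by omega))
  exact not_isProperEdgeColouring_petersenGraph _ (hc.toFin hc₃)

end Petersen

end ListRainbow

theorem mainTheorem6 :
    ListRainbow.listRainbowConnectionNumber ListRainbow.petersenGraph = 3 ∧
      ListRainbow.listStrongRainbowConnectionNumber ListRainbow.petersenGraph = 4 :=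
  ⟨ListRainbow.listRainbowConnectionNumber_petersenGraph,
    ListRainbow.listStrongRainbowConnectionNumber_petersenGraph⟩
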